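/- Let $G=(V,E^+\uplus E^-,w)$ be a weighted correlation clustering instance: a complete signed graph on a finite set $V$ of $n$ vertices with edge weights $w_e\ge 0$ and total weight $W=\sum_e w_e>0$. For a clustering (partition) $\mathcal C$ of $V$, let $\mathrm{obj}_G(\mathcal C)$ be the total weight of the disagreements of $\mathcal C$, that is, of the edges of $E^+$ whose ends lie in different clusters and the edges of $E^-$ whose ends lie in the same cluster. Let $\mathcal H_G$ be the family of the sets of disagreements of all clusterings $\mathcal C$ of $V$, and let $d=n-1$; then $\mathrm{VC}(\mathcal H_G)=d$. Moreover, for every $\varepsilon_0\in(0,1)$ there is a constant $c>0$, depending only on $\varepsilon_0$, such that the following holds for every such $G$ and all $\varepsilon\in(0,\varepsilon_0]$, $\delta\in(0,1)$ and $\tau>0$. Sample $m$ edges independently from the distribution $p(e)=w_e/W$, and let $H$ be the instance with the signs of $G$ in which each sampled edge has weight $W/m$ (summing weights over repeats) and all other edges have weight $0$. If $$m\ \ge\ c\cdot\frac{d\log(1/\varepsilon)+\log(1/\delta)}{\varepsilon^2}\cdot\frac{W^2}{\tau^2},$$ then with probability at least $1-\delta$, simultaneously for all clusterings $\mathcal C$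 of $V$, $$\mathrm{obj}_G(\mathcal C)\ge\tau\ \Longrightarrow\ |\mathrm{obj}_H(\mathcal C)-\mathrm{obj}_G(\mathcal C)|\le\varepsilon\,\mathrm{obj}_G(\mathcal C),$$ and $$|\mathrm{obj}_H(\mathcal C)-\mathrm{obj}_G(\mathcal C)|\le\varepsilon\max\{\mathrm{obj}_G(\mathcal C),\tau\}.$$ -/

import Mathlib

namespace CorrelationClustering

/-- Edges of the complete graph on `V`: unordered pairs of distinct vertices. -/
def Edge (V : Type*) : Type _ := {e : Sym2 V // ¬ e.IsDiag}

instance (V : Type*) [DecidableEq V] : DecidableEq (Edge V) :=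
  inferInstanceAs (DecidableEq {e : Sym2 V // ¬ e.IsDiag})

instance (V : Type*) [DecidableEq V] [Fintype V] : Fintype (Edge V) :=
  inferInstanceAs (Fintype {e : Sym2 V // ¬ e.IsDiag})

/-- Every set of edges is measurable (the edge set is used only for finite `V`). -/
instance (V : Type*) : MeasurableSpace (Edge V) := ⊤

instance (V : Type*) : DiscreteMeasurableSpace (Edge V) := ⟨fun _ => trivial⟩

/-- A weighted correlation clustering instance on `V`: a complete signed graph with nonnegative
edge weights. The negative edges are those outside `pos`. -/
structure Instance (V : Type*) where
  /-- the positive edges -/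
  pos : Finset (Edge V)
  /-- the edge weights -/
  weight : Edge V → ℝ
  weight_nonneg : ∀ e, 0 ≤ weight e

/-- A clustering is a partition of the vertex set. -/
abbrev Clustering (V : Type*) [DecidableEq V] [Fintype V] : Type _ :=
  Finpartition (Finset.univ : Finset V)

/-- `sep C e` is `0` if the two ends of `e` lie in the same cluster of `C`, and `1` otherwise. -/
def sep {V : Type*} [DecidableEq V] [Fintype V] (C : Clustering V) (e : Edge V) : ℝ :=
  if ∃ A ∈ C.parts, ∀ v ∈ e.1, v ∈ A then 0 else 1

namespace Instance

variable {V : Type*} [DecidableEq V] [Fintype V]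

/-- The cost of a clustering: the weight of the cut positive edges plus the weight of the uncut
negative edges. -/
noncomputable def obj (G : Instance V) (C : Clustering V) : ℝ :=
  ∑ e ∈ G.pos, G.weight e * sep C e + ∑ e ∈ G.posᶜ, G.weight e * (1 - sep C e)

/-- The total edge weight. -/
noncomputable def totalWeight (G : Instance V) : ℝ := ∑ e, G.weight e

/-- The edges on which a clustering disagrees with the signs. -/
noncomputable def disagreements (G : Instance V) (C : Clustering V) : Finset (Edge V) :=
  Finset.univ.filter fun e => (e ∈ G.pos ∧ sep C e = 1) ∨ (e ∉ G.pos ∧ sep C e = 0)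

open Classical in
/-- The class of all disagreement sets of clusterings, as a set system on the edges. -/
noncomputable def disagreementClass (G : Instance V) : Finset (Finset (Edge V)) :=
  Finset.univ.filter fun D => ∃ C : Clustering V, G.disagreements C = D

/-- The distribution on edges with probabilities proportional to the weights. -/
noncomputable def edgeDist (G : Instance V) (hW : 0 < G.totalWeight) : PMF (Edge V) :=
  PMF.ofFintype (fun e => ENNReal.ofReal (G.weight e / G.totalWeight)) (by
    rw [← ENNReal.ofReal_sum_of_nonneg fun e _ => div_nonneg (G.weight_nonneg e) hW.le,
      ← Finset.sum_div]
    change ENNReal.ofReal (G.totalWeight / G.totalWeight) = 1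
    rw [div_self hW.ne', ENNReal.ofReal_one])

/-- The law of `m` independent edges drawn from `edgeDist`. -/
noncomputable def sampleLaw (G : Instance V) (hW : 0 < G.totalWeight) (m : ℕ) :
    MeasureTheory.Measure (Fin m → Edge V) :=
  MeasureTheory.Measure.pi fun _ => (G.edgeDist hW).toMeasure

/-- The instance `H` obtained from a sample `s` of `m` edges: signs are kept, and each occurrence
of an edge in the sample contributes weight `W / m` to it, where `W` is the total weight. -/
noncomputable def sampled (G : Instance V) {m : ℕ} (s : Fin m → Edge V) : Instance V where
  pos := G.pos
  weight e := ∑ i, if s i = e then G.totalWeight / m else 0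
  weight_nonneg e := Finset.sum_nonneg fun i _ => by
    split_ifs
    · exact div_nonneg (Finset.sum_nonneg fun e _ => G.weight_nonneg e) (Nat.cast_nonneg m)
    · exact le_rfl

end Instance

end CorrelationClustering

/-! The cost of a clustering is `W` times the probability of its disagreement set under the edge
distribution, and its sampled cost is `W / m` times the number of sample points in that set. The
claim is thus a uniform relative deviation bound for a set system of VC dimension `d`, with
threshold `p = τ / W`.

That bound, `weightOf_exists_far_le`, is proved by symmetrization. A set with a large deviation
gives, with probability at least 1/2 over a second sample, a large discrepancy between the two
samples. Random swaps of paired entries keep the total count of a set fixed, so Hoeffding's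
inequality handles each trace on the double sample, and Sauer–Shelah (`card_image_inter_mul_pow_le`)
pays for the union over traces. This needs `m` of order `(d log(1/(ε²p)) + log(1/δ)) / (ε²p)`. The
hypothesis offers `1/p²` instead of `1/p`; the spare factor absorbs `log(1/p)`, and `log(1/ε) ≥
log(1/ε₀) > 0` absorbs the constants.

For the dimension, a shattered edge set is independent in the graphic matroid
(`card_le_of_forall_exists_cut`), and a spanning star is shattered (`exists_clustering_star`). -/

namespace CorrelationClustering

open Finset

/-! ### Finite weighted sums in place of probabilities. -/

section FiniteProbability

open Classical in
/-- The total weight of the points satisfying `P`. -/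
noncomputable def weightOf {Ω : Type*} [Fintype Ω] (w : Ω → ℝ) (P : Ω → Prop) : ℝ :=
  ∑ x, w x * if P x then 1 else 0

variable {Ω : Type*} [Fintype Ω] {w : Ω → ℝ}

lemma weightOf_le_sum_mul (hw : ∀ x, 0 ≤ w x) {P : Ω → Prop} {F : Ω → ℝ} (hF : ∀ x, 0 ≤ F x)
    (hP : ∀ x, P x → 1 ≤ F x) : weightOf w P ≤ ∑ x, w x * F x := by
  refine sum_le_sum fun x _ => mul_le_mul_of_nonneg_left ?_ (hw x)
  split_ifs with h
  exacts [hP x h, hF x]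

lemma weightOf_mono (hw : ∀ x, 0 ≤ w x) {P Q : Ω → Prop} (h : ∀ x, P x → Q x) :
    weightOf w P ≤ weightOf w Q := by
  classical
  refine weightOf_le_sum_mul hw (fun x => by split_ifs <;> norm_num) fun x hx => ?_
  rw [if_pos (h x hx)]

lemma weightOf_nonneg (hw : ∀ x, 0 ≤ w x) (P : Ω → Prop) : 0 ≤ weightOf w P :=
  sum_nonneg fun x _ => mul_nonneg (hw x) (by split_ifs <;> norm_num)

lemma weightOf_add_weightOf_not (P : Ω → Prop) :
    weightOf w P + weightOf w (fun x => ¬ P x) = ∑ x, w x := by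
  rw [weightOf, weightOf, ← sum_add_distrib]
  refine sum_congr rfl fun x _ => ?_
  by_cases h : P x <;> simp [h]

/-- The exponential Markov inequality, in both directions. -/
lemma weightOf_le_abs_le (hw : ∀ x, 0 ≤ w x) (F : Ω → ℝ) (lam t : ℝ) (hlam : 0 ≤ lam) :
    weightOf w (fun x => t ≤ |F x|) ≤ Real.exp (-(lam * t)) *
      (∑ x, w x * Real.exp (lam * F x) + ∑ x, w x * Real.exp (-lam * F x)) := by
  have h : ∀ x, t ≤ |F x| → 1 ≤ Real.exp (-(lam * t)) *
      (Real.exp (lam * F x) + Real.exp (-lam * F x)) := fun x hx => by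
    rw [mul_add, ← Real.exp_add, ← Real.exp_add]
    rcases le_abs.1 hx with h | h
    · have : 1 ≤ Real.exp (-(lam * t) + lam * F x) := Real.one_le_exp (by nlinarith)
      linarith [Real.exp_pos (-(lam * t) + -lam * F x)]
    · have : 1 ≤ Real.exp (-(lam * t) + -lam * F x) := Real.one_le_exp (by nlinarith)
      linarith [Real.exp_pos (-(lam * t) + lam * F x)]
  refine (weightOf_le_sum_mul hw (fun x => by positivity) h).trans_eq ?_
  rw [← sum_add_distrib, mul_sum]
  exact sum_congr rfl fun x _ => by ring

end FiniteProbability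

/-! ### Random signs. -/

section Rademacher

variable {m : ℕ}

lemma sum_prod_pi {β : Type*} [Fintype β] (g : Fin m → β → ℝ) :
    ∑ s : Fin m → β, ∏ i, g i (s i) = ∏ i, ∑ b, g i b := by
  classical
  rw [prod_univ_sum, Fintype.piFinset_univ]

lemma sum_exp_signed_sum_le (x : Fin m → ℝ) (lam S : ℝ) (hS : ∑ i, x i ^ 2 ≤ S) :
    ∑ σ : Fin m → Bool, Real.exp (lam * ∑ i, if σ i then -x i else x i) ≤
      2 ^ m * Real.exp (lam ^ 2 * S / 2) := by
  have h1 : ∀ σ : Fin m → Bool, Real.exp (lam * ∑ i, if σ i then -x i else x i) =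
      ∏ i, Real.exp (lam * if σ i then -x i else x i) := fun σ => by
    rw [← Real.exp_sum, mul_sum]
  simp_rw [h1]
  rw [sum_prod_pi fun i (b : Bool) => Real.exp (lam * if b then -x i else x i)]
  calc ∏ i, ∑ b : Bool, Real.exp (lam * if b then -x i else x i)
      ≤ ∏ i, (2 * Real.exp ((lam * x i) ^ 2 / 2)) := by
        refine prod_le_prod (fun i _ => by positivity) fun i _ => ?_
        have := Real.cosh_le_exp_half_sq (lam * x i)
        rw [Real.cosh_eq] at this
        simp only [Fintype.sum_bool, if_true, Bool.false_eq_true, if_false, mul_neg]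
        linarith
    _ = 2 ^ m * Real.exp (lam ^ 2 * (∑ i, x i ^ 2) / 2) := by
        rw [prod_mul_distrib, ← Real.exp_sum, prod_const, card_univ, Fintype.card_fin, mul_sum,
          sum_div]
        simp_rw [mul_pow]
    _ ≤ _ := by gcongr

/-- Hoeffding's inequality for random signs. -/
lemma weightOf_signed_sum_le (x : Fin m → ℝ) {S t : ℝ} (hS0 : 0 < S) (ht : 0 ≤ t)
    (hS : ∑ i, x i ^ 2 ≤ S) :
    weightOf (fun _ => 1) (fun σ : Fin m → Bool => t ≤ |∑ i, if σ i then -x i else x i|) ≤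
      2 ^ m * (2 * Real.exp (-(t ^ 2 / (2 * S)))) := by
  -- The value `lam = t / S` minimises `-lam * t + lam ^ 2 * S / 2`.
  refine (weightOf_le_abs_le (fun _ => zero_le_one) _ (t / S) t (by positivity)).trans ?_
  simp only [one_mul]
  have h1 := sum_exp_signed_sum_le x (t / S) S hS
  have h2 := sum_exp_signed_sum_le x (-(t / S)) S hS
  rw [neg_sq] at h2
  calc _ ≤ Real.exp (-(t / S * t)) * (2 ^ m * Real.exp ((t / S) ^ 2 * S / 2) +
        2 ^ m * Real.exp ((t / S) ^ 2 * S / 2)) := by gcongr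
    _ = 2 ^ m * (2 * (Real.exp (-(t / S * t)) * Real.exp ((t / S) ^ 2 * S / 2))) := by ring
    _ = _ := by
        rw [← Real.exp_add]
        congr 3
        field_simp
        ring

end Rademacher

/-! ### Concentration of hit counts for one fixed set. -/

section Sampling

variable {α : Type*} [Fintype α] [DecidableEq α] {m : ℕ} {q : α → ℝ}

/-- The number of sample points that fall in `D`. -/
def hitCount (D : Finset α) (s : Fin m → α) : ℝ := ∑ i, if s i ∈ D then 1 else 0

/-- The indicator is Bernoulli, and `exp lam ≤ 1 + lam + lam ^ 2` on `|lam| ≤ 1`. The exponent is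
proportional to the mean, which is what makes the deviations relative. -/
lemma sum_mul_exp_le (hq : ∀ a, 0 ≤ q a) (hq1 : ∑ a, q a = 1) (D : Finset α) {lam : ℝ}
    (hlam : |lam| ≤ 1) :
    ∑ a, q a * Real.exp (lam * ((if a ∈ D then 1 else 0) - ∑ b ∈ D, q b)) ≤
      Real.exp (lam ^ 2 * ∑ b ∈ D, q b) := by
  set μ := ∑ b ∈ D, q b with hμ
  have hμ0 : 0 ≤ μ := sum_nonneg fun b _ => hq b
  have h1 : ∑ a, q a * Real.exp (lam * ((if a ∈ D then 1 else 0) - μ)) =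
      Real.exp (-(lam * μ)) * (1 + μ * (Real.exp lam - 1)) := by
    have : ∀ a, q a * Real.exp (lam * ((if a ∈ D then 1 else 0) - μ)) =
        Real.exp (-(lam * μ)) * (q a + (if a ∈ D then q a else 0) * (Real.exp lam - 1)) := by
      intro a
      rw [mul_sub, sub_eq_neg_add, Real.exp_add]
      split_ifs <;> simp <;> ring
    simp_rw [this]
    rw [← mul_sum, sum_add_distrib, hq1, ← sum_mul, ← sum_filter, filter_univ_mem]
  have h2 : Real.exp lam - 1 ≤ lam + lam ^ 2 := by
    linarith [(abs_le.1 (Real.abs_exp_sub_one_sub_id_le hlam)).2]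
  rw [h1]
  calc _ ≤ Real.exp (-(lam * μ)) * Real.exp (μ * (lam + lam ^ 2)) := by
        gcongr
        refine le_trans ?_ (Real.add_one_le_exp _)
        nlinarith
    _ = _ := by
        rw [← Real.exp_add]
        congr 1
        ring

lemma sum_prod_mul_exp_le (hq : ∀ a, 0 ≤ q a) (hq1 : ∑ a, q a = 1) (D : Finset α) {lam : ℝ}
    (hlam : |lam| ≤ 1) :
    ∑ s : Fin m → α, (∏ i, q (s i)) * Real.exp (lam * (hitCount D s - m * ∑ b ∈ D, q b)) ≤
      Real.exp (m * (lam ^ 2 * ∑ b ∈ D, q b)) := by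
  have h : ∀ s : Fin m → α,
      (∏ i, q (s i)) * Real.exp (lam * (hitCount D s - m * ∑ b ∈ D, q b)) =
      ∏ i, (q (s i) * Real.exp (lam * ((if s i ∈ D then 1 else 0) - ∑ b ∈ D, q b))) := by
    intro s
    rw [prod_mul_distrib, ← Real.exp_sum, ← mul_sum, sum_sub_distrib]
    simp [hitCount]
  simp_rw [h]
  rw [sum_prod_pi fun _ a => q a * Real.exp (lam * ((if a ∈ D then 1 else 0) - ∑ b ∈ D, q b)),
    prod_const, card_univ, Fintype.card_fin, Real.exp_nat_mul]
  exact pow_le_pow_left₀ (sum_nonneg fun a _ => mul_nonneg (hq a) (Real.exp_pos _).le)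
    (sum_mul_exp_le hq hq1 D hlam) m

omit [DecidableEq α] in
lemma sum_prod_eq_one (hq1 : ∑ a, q a = 1) : ∑ s : Fin m → α, ∏ i, q (s i) = 1 := by
  rw [sum_prod_pi fun _ a => q a]
  simp [hq1]

/-- A multiplicative Chernoff bound, in the weak form needed for symmetrization. -/
lemma half_le_weightOf_hitCount_near (hq : ∀ a, 0 ≤ q a) (hq1 : ∑ a, q a = 1) (D : Finset α)
    {ε p : ℝ} (hε : 0 < ε) (hε1 : ε ≤ 1) (hm : 256 ≤ m * ε ^ 2 * p) :
    1 / 2 ≤ weightOf (fun s : Fin m → α => ∏ i, q (s i)) (fun s =>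
      |hitCount D s - m * ∑ b ∈ D, q b| < ε / 4 * (m * max (∑ b ∈ D, q b) p)) := by
  set μ := ∑ b ∈ D, q b with hμ
  set M := max μ p
  have hw : ∀ s : Fin m → α, 0 ≤ ∏ i, q (s i) := fun s => prod_nonneg fun i _ => hq _
  have hadd := weightOf_add_weightOf_not (w := fun s : Fin m → α => ∏ i, q (s i))
    (fun s => |hitCount D s - m * μ| < ε / 4 * (m * M))
  rw [sum_prod_eq_one hq1] at hadd
  simp only [not_lt] at hadd
  -- The value `ε / 8` minimises `-lam * (ε / 4) + lam ^ 2`. The exponent becomes at most `-m * ε ^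
  -- 2 * M / 64 ≤ -4`.
  have htail := weightOf_le_abs_le hw (fun s => hitCount D s - m * μ) (ε / 8)
    (ε / 4 * (m * M)) (by positivity)
  have habs : |ε / 8| ≤ 1 := by rw [abs_of_pos (by positivity)]; linarith
  have h1 := sum_prod_mul_exp_le (m := m) hq hq1 D habs
  have h2 := sum_prod_mul_exp_le (m := m) hq hq1 D (lam := -(ε / 8)) (by rwa [abs_neg])
  rw [neg_sq] at h2
  have h3 : Real.exp (-(ε / 8 * (ε / 4 * (m * M)))) * (Real.exp (m * ((ε / 8) ^ 2 * μ)) +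
      Real.exp (m * ((ε / 8) ^ 2 * μ))) ≤ 2 * Real.exp (-4) := by
    rw [← two_mul, mul_left_comm, ← Real.exp_add]
    gcongr
    have hμM : m * ε ^ 2 * μ ≤ m * ε ^ 2 * M := by gcongr; exact le_max_left _ _
    have hpM : m * ε ^ 2 * p ≤ m * ε ^ 2 * M := by gcongr; exact le_max_right _ _
    nlinarith
  have h4 : Real.exp (-4) ≤ 1 / 4 := by
    rw [Real.exp_neg, one_div]
    exact inv_anti₀ (by norm_num) (by linarith [Real.add_one_le_exp 4])
  have h5 : Real.exp (-(ε / 8 * (ε / 4 * (m * M)))) *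
      (∑ s : Fin m → α, (∏ i, q (s i)) * Real.exp (ε / 8 * (hitCount D s - m * μ)) +
        ∑ s : Fin m → α, (∏ i, q (s i)) * Real.exp (-(ε / 8) * (hitCount D s - m * μ))) ≤ _ :=
    mul_le_mul_of_nonneg_left (add_le_add h1 h2) (Real.exp_pos _).le
  linarith

end Sampling

/-! ### Counting traces. -/

section SauerShelah

variable {α : Type*} [DecidableEq α]

/-- A generating function form of the Sauer–Shelah bound for the traces on a set `T`. -/
lemma card_image_inter_mul_pow_le (H : Finset (Finset α)) (T : Finset α) {x : ℝ} (hx : 0 < x)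
    (hx1 : x ≤ 1) : #(H.image (T ∩ ·)) * x ^ H.vcDim ≤ (1 + x) ^ #T := by
  set K := H.image (T ∩ ·) with hK
  have hsh : ∀ A, K.Shatters A → A ⊆ T ∧ H.Shatters A := by
    intro A hA
    have hAT : A ⊆ T := by
      obtain ⟨t, ht, hAt⟩ := hA.exists_superset
      obtain ⟨D, -, rfl⟩ := mem_image.1 ht
      exact hAt.trans inter_subset_left
    refine ⟨hAT, fun t ht => ?_⟩
    obtain ⟨u, hu, rfl⟩ := hA ht
    obtain ⟨D, hD, rfl⟩ := mem_image.1 hu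
    exact ⟨D, hD, by rw [← inter_assoc, inter_eq_left.2 hAT]⟩
  -- Pajor's inequality: a family has at most as many members as it shatters sets. Those sets have
  -- size at most `H.vcDim`, so for `x ≤ 1` each may be weighted by `x ^ #A`, and the sum extends to
  -- all subsets of `T`.
  calc (#K : ℝ) * x ^ H.vcDim ≤ #K.shatterer * x ^ H.vcDim :=
        mul_le_mul_of_nonneg_right (by exact_mod_cast card_le_card_shatterer K) (by positivity)
    _ = ∑ A ∈ K.shatterer, x ^ H.vcDim := by rw [sum_const, nsmul_eq_mul]
    _ ≤ ∑ A ∈ K.shatterer, x ^ #A := sum_le_sum fun A hA =>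
        pow_le_pow_of_le_one hx.le hx1 (hsh A (mem_shatterer.1 hA)).2.card_le_vcDim
    _ ≤ ∑ A ∈ T.powerset, x ^ #A := sum_le_sum_of_subset_of_nonneg
        (fun A hA => mem_powerset.2 (hsh A (mem_shatterer.1 hA)).1) fun _ _ _ => by positivity
    _ = (1 + x) ^ #T := by
        rw [← prod_const, prod_one_add]
        simp

end SauerShelah

/-! ### The uniform relative deviation bound. -/

section Symmetrization

variable {α : Type*} [Fintype α] [DecidableEq α] {m : ℕ} {q : α → ℝ}

/-- Exchange the entries of two samples at the positions selected by `σ`. -/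
def swapBy (σ : Fin m → Bool) (z : (Fin m → α) × (Fin m → α)) : (Fin m → α) × (Fin m → α) :=
  (fun i => if σ i then z.2 i else z.1 i, fun i => if σ i then z.1 i else z.2 i)

omit [Fintype α] [DecidableEq α] in
lemma swapBy_involutive (σ : Fin m → Bool) :
    Function.Involutive (swapBy σ : (Fin m → α) × (Fin m → α) → _) := by
  rintro ⟨s, s'⟩
  refine Prod.ext (funext fun i => ?_) (funext fun i => ?_) <;>
  · simp only [swapBy]
    split_ifs <;> rfl

omit [Fintype α] in
lemma hitCount_swapBy_add (D : Finset α) (σ : Fin m → Bool) (z : (Fin m → α) × (Fin m → α)) :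
    hitCount D (swapBy σ z).1 + hitCount D (swapBy σ z).2 = hitCount D z.1 + hitCount D z.2 := by
  simp only [hitCount, ← sum_add_distrib, swapBy]
  refine sum_congr rfl fun i _ => ?_
  rcases Bool.eq_false_or_eq_true (σ i) with h | h <;> simp [h, add_comm]

omit [Fintype α] in
lemma hitCount_swapBy_sub (D : Finset α) (σ : Fin m → Bool) (z : (Fin m → α) × (Fin m → α)) :
    hitCount D (swapBy σ z).1 - hitCount D (swapBy σ z).2 =
      ∑ i, if σ i then -((if z.1 i ∈ D then 1 else 0) - if z.2 i ∈ D then 1 else 0)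
        else ((if z.1 i ∈ D then (1 : ℝ) else 0) - if z.2 i ∈ D then 1 else 0) := by
  simp only [hitCount, ← sum_sub_distrib, swapBy]
  refine sum_congr rfl fun i _ => ?_
  rcases Bool.eq_false_or_eq_true (σ i) with h | h <;> simp [h]

omit [DecidableEq α] in
-- Swapping preserves the product law of the double sample, so the weight of `B` equals its average
-- over all swaps, which can be bounded with the double sample held fixed.
lemma weightOf_le_of_swapBy (hq : ∀ a, 0 ≤ q a) (hq1 : ∑ a, q a = 1)
    (B : (Fin m → α) × (Fin m → α) → Prop) {K : ℝ}
    (hB : ∀ z, weightOf (fun _ => 1) (fun σ : Fin m → Bool => B (swapBy σ z)) ≤ 2 ^ m * K) :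
    weightOf (fun z : (Fin m → α) × (Fin m → α) => (∏ i, q (z.1 i)) * ∏ i, q (z.2 i)) B ≤ K := by
  classical
  set w := fun z : (Fin m → α) × (Fin m → α) => (∏ i, q (z.1 i)) * ∏ i, q (z.2 i)
  have hw : ∀ z, 0 ≤ w z := fun z =>
    mul_nonneg (prod_nonneg fun i _ => hq _) (prod_nonneg fun i _ => hq _)
  have hwswap : ∀ σ z, w (swapBy σ z) = w z := fun σ z => by
    simp only [w, ← prod_mul_distrib, swapBy]
    refine prod_congr rfl fun i _ => ?_
    cases σ i <;> simp [mul_comm]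
  have hw1 : ∑ z, w z = 1 := by
    rw [Fintype.sum_prod_type]
    simp only [w, ← mul_sum, sum_prod_eq_one hq1, mul_one]
  have h1 : ∀ σ : Fin m → Bool, weightOf w B = ∑ z, w z * if B (swapBy σ z) then 1 else 0 := by
    intro σ
    rw [weightOf, ← (swapBy_involutive σ).bijective.sum_comp]
    simp only [hwswap]
  have h2 : 2 ^ m * weightOf w B ≤ 2 ^ m * K := by
    calc 2 ^ m * weightOf w B = ∑ _σ : Fin m → Bool, weightOf w B := by simp
      _ = ∑ z, w z * weightOf (fun _ => 1) (fun σ : Fin m → Bool => B (swapBy σ z)) := by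
        rw [sum_congr rfl fun σ _ => h1 σ, sum_comm]
        refine sum_congr rfl fun z _ => ?_
        rw [← mul_sum, weightOf]
        simp only [one_mul]
      _ ≤ ∑ z, w z * (2 ^ m * K) :=
        sum_le_sum fun z _ => mul_le_mul_of_nonneg_left (hB z) (hw z)
      _ = 2 ^ m * K := by rw [← sum_mul, hw1, one_mul]
  exact le_of_mul_le_mul_left h2 (by positivity)

omit [Fintype α] in
lemma hitCount_inter {T : Finset α} {s : Fin m → α} (hs : ∀ i, s i ∈ T) (D : Finset α) :
    hitCount (T ∩ D) s = hitCount D s := by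
  simp [hitCount, hs]

omit [Fintype α] in
/-- For a fixed double sample, random swaps rarely produce a large discrepancy on any member of
`H`. -/
lemma weightOf_exists_discrepancy_le (H : Finset (Finset α)) {ε p : ℝ} (hε : 0 < ε)
    (hε1 : ε ≤ 1) (hp : 0 < p) (hp1 : p ≤ 1) (hm : 0 < m) (z : (Fin m → α) × (Fin m → α)) :
    weightOf (fun _ => 1) (fun σ : Fin m → Bool => ∃ D ∈ H,
      ε / 8 * max (hitCount D (swapBy σ z).1 + hitCount D (swapBy σ z).2) (m * p) ≤
        |hitCount D (swapBy σ z).1 - hitCount D (swapBy σ z).2|) ≤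
      2 ^ m * (2 * Real.exp (H.vcDim * Real.log (512 / (ε ^ 2 * p)) - m * ε ^ 2 * p / 256)) := by
  classical
  set T := univ.image z.1 ∪ univ.image z.2 with hT
  have hz1 : ∀ i, z.1 i ∈ T := fun i => by simp [hT]
  have hz2 : ∀ i, z.2 i ∈ T := fun i => by simp [hT]
  have hTcard : #T ≤ 2 * m := by
    refine (card_union_le _ _).trans ?_
    have h1 := card_image_le (s := univ) (f := z.1)
    have h2 := card_image_le (s := univ) (f := z.2)
    rw [card_univ, Fintype.card_fin] at h1 h2
    omega
  have hm' : (0 : ℝ) < m := by exact_mod_cast hm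
  set bad : Finset α → (Fin m → Bool) → Prop := fun D σ =>
    ε / 8 * max (hitCount D z.1 + hitCount D z.2) (m * p) ≤
      |∑ i, if σ i then -((if z.1 i ∈ D then 1 else 0) - if z.2 i ∈ D then 1 else 0)
        else ((if z.1 i ∈ D then (1 : ℝ) else 0) - if z.2 i ∈ D then 1 else 0)| with hbad
  have hone : ∀ D, weightOf (fun _ => 1) (bad D) ≤
      2 ^ m * (2 * Real.exp (-(m * ε ^ 2 * p / 128))) := by
    intro D
    set S := max (hitCount D z.1 + hitCount D z.2) (m * p)
    -- `S` bounds the sum of squared increments and also scales the threshold, so the Hoeffding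
    -- exponent is linear in `S` and `S ≥ m * p` finishes.
    have hS : 0 < S := lt_max_of_lt_right (by positivity)
    refine (weightOf_signed_sum_le _ (S := S) (t := ε / 8 * S) hS (by positivity) ?_).trans ?_
    · refine le_trans ?_ (le_max_left _ _)
      simp only [hitCount, ← sum_add_distrib]
      refine sum_le_sum fun i _ => ?_
      split_ifs <;> norm_num
    · have : m * p ≤ S := le_max_right _ _
      refine mul_le_mul_of_nonneg_left (mul_le_mul_of_nonneg_left (Real.exp_le_exp.2
        (neg_le_neg ?_)) zero_le_two) (by positivity)
      rw [show (ε / 8 * S) ^ 2 / (2 * S) = ε ^ 2 * S / 128 by field_simp; norm_num]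
      nlinarith [mul_le_mul_of_nonneg_left this (sq_nonneg ε)]
  have hunion : weightOf (fun _ => 1) (fun σ : Fin m → Bool => ∃ D ∈ H,
      ε / 8 * max (hitCount D (swapBy σ z).1 + hitCount D (swapBy σ z).2) (m * p) ≤
        |hitCount D (swapBy σ z).1 - hitCount D (swapBy σ z).2|) ≤
      ∑ D ∈ H.image (T ∩ ·), weightOf (fun _ => 1) (bad D) := by
    simp only [weightOf, one_mul]
    rw [sum_comm]
    refine sum_le_sum fun σ _ => ?_
    have hnn : ∀ D ∈ H.image (T ∩ ·), (0 : ℝ) ≤ if bad D σ then 1 else 0 :=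
      fun D _ => by split_ifs <;> norm_num
    split_ifs with h
    · obtain ⟨D, hD, h⟩ := h
      refine le_trans ?_ (single_le_sum hnn (mem_image_of_mem _ hD))
      rw [if_pos]
      rw [hitCount_swapBy_add, hitCount_swapBy_sub] at h
      simpa only [hbad, hitCount_inter hz1, hitCount_inter hz2, mem_inter, hz1, hz2,
        true_and] using h
    · exact sum_nonneg hnn
  refine hunion.trans ((sum_le_sum fun D _ => hone D).trans ?_)
  rw [sum_const, nsmul_eq_mul]
  -- With this `x`, `(1 + x) ^ (2 * m)` costs at most `exp (m * ε ^ 2 * p / 256)`, half of the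
  -- Hoeffding exponent. No logarithm of `m` arises.
  set x := ε ^ 2 * p / 512 with hx
  have hx0 : 0 < x := by positivity
  have hx1 : x ≤ 1 := by
    have : ε ^ 2 * p ≤ 1 := mul_le_one₀ (pow_le_one₀ hε.le hε1) hp.le hp1
    rw [hx]
    linarith
  have hcard : (#(H.image (T ∩ ·)) : ℝ) ≤
      Real.exp (H.vcDim * Real.log (512 / (ε ^ 2 * p)) + m * ε ^ 2 * p / 256) := by
    have h1 := card_image_inter_mul_pow_le H T hx0 hx1
    have h2 : (1 + x) ^ #T ≤ Real.exp (m * ε ^ 2 * p / 256) := by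
      calc (1 + x) ^ #T ≤ (1 + x) ^ (2 * m) := pow_le_pow_right₀ (by linarith) hTcard
        _ ≤ Real.exp x ^ (2 * m) := by
            gcongr
            linarith [Real.add_one_le_exp x]
        _ = _ := by
            rw [← Real.exp_nat_mul]
            congr 1
            push_cast
            rw [hx]
            ring
    have h3 : Real.exp (H.vcDim * Real.log (512 / (ε ^ 2 * p))) * x ^ H.vcDim = 1 := by
      rw [Real.exp_nat_mul, Real.exp_log (by positivity), ← mul_pow, hx,
        div_mul_div_cancel₀ (by positivity), div_self (by norm_num), one_pow]
    calc (#(H.image (T ∩ ·)) : ℝ) = Real.exp (H.vcDim * Real.log (512 / (ε ^ 2 * p))) *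
          (#(H.image (T ∩ ·)) * x ^ H.vcDim) := by
          rw [mul_left_comm, h3, mul_one]
      _ ≤ _ := by
          rw [Real.exp_add]
          gcongr
          exact h1.trans h2
  calc (#(H.image (T ∩ ·)) : ℝ) * (2 ^ m * (2 * Real.exp (-(m * ε ^ 2 * p / 128))))
      ≤ Real.exp (H.vcDim * Real.log (512 / (ε ^ 2 * p)) + m * ε ^ 2 * p / 256) *
        (2 ^ m * (2 * Real.exp (-(m * ε ^ 2 * p / 128)))) := by gcongr
    _ = 2 ^ m * (2 * (Real.exp (H.vcDim * Real.log (512 / (ε ^ 2 * p)) + m * ε ^ 2 * p / 256) *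
        Real.exp (-(m * ε ^ 2 * p / 128)))) := by ring
    _ = _ := by
        rw [← Real.exp_add]
        congr 3
        ring

/-- Here `a` and `b` are the counts in the sample and the ghost sample, and `c` is their mean. For
`a ≤ 4 * M` the sum `a + b` is at most `21 / 4 * M`, so the gap `3 / 4 * (ε * M)` suffices; for
larger `a` the difference is comparable with `a` itself. -/
lemma discrepancy_of_far_of_near {ε M P a b c : ℝ} (hε : 0 < ε) (hε1 : ε ≤ 1) (hM : 0 < M)
    (hPM : P ≤ M) (hcM : c ≤ M) (ha : ε * M < |a - c|) (hb : |b - c| < ε / 4 * M) :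
    ε / 8 * max (a + b) P ≤ |a - b| := by
  have hεM : 0 < ε * M := by positivity
  have hεM1 : ε * M ≤ M := mul_le_of_le_one_left hM.le hε1
  have hab : 3 / 4 * (ε * M) ≤ |a - b| := by
    have := abs_sub_le a b c
    linarith
  have hb' := abs_lt.1 hb
  rw [mul_max_of_nonneg _ _ (by positivity)]
  refine max_le ?_ (by nlinarith)
  rcases le_or_gt a (4 * M) with h | h
  · nlinarith
  · have h1 := le_abs_self (a - b)
    rcases le_or_gt 0 (a + b) with h0 | h0 <;> nlinarith

/-- A relative deviation bound for set systems of bounded VC dimension. -/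
theorem weightOf_exists_far_le (hq : ∀ a, 0 ≤ q a) (hq1 : ∑ a, q a = 1) (H : Finset (Finset α))
    {ε p δ : ℝ} (hε : 0 < ε) (hε1 : ε ≤ 1) (hp : 0 < p) (hp1 : p ≤ 1) (hδ : 0 < δ) (hδ1 : δ < 1)
    (hm : H.vcDim * Real.log (512 / (ε ^ 2 * p)) + Real.log (4 / δ) ≤ m * ε ^ 2 * p / 256) :
    weightOf (fun s : Fin m → α => ∏ i, q (s i)) (fun s => ∃ D ∈ H,
      ε * (m * max (∑ b ∈ D, q b) p) < |hitCount D s - m * ∑ b ∈ D, q b|) ≤ δ := by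
  classical
  have hlog4 : 1 ≤ Real.log (4 / δ) := by
    rw [Real.le_log_iff_exp_le (by positivity), le_div_iff₀ hδ]
    nlinarith [Real.exp_one_lt_d9, Real.exp_pos 1]
  have hεp : ε ^ 2 * p ≤ 1 := mul_le_one₀ (pow_le_one₀ hε.le hε1) hp.le hp1
  have hlog : 0 ≤ Real.log (512 / (ε ^ 2 * p)) := by
    refine Real.log_nonneg ?_
    rw [le_div_iff₀ (by positivity)]
    linarith
  have hm256 : 256 ≤ m * ε ^ 2 * p := by
    have : 0 ≤ (H.vcDim : ℝ) * Real.log (512 / (ε ^ 2 * p)) := by positivity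
    linarith
  have hm0 : 0 < m := by
    rcases Nat.eq_zero_or_pos m with rfl | h
    · norm_num at hm256
    · exact h
  have hm' : (0 : ℝ) < m := by exact_mod_cast hm0
  set w := fun s : Fin m → α => ∏ i, q (s i) with hwdef
  have hw : ∀ s, 0 ≤ w s := fun s => prod_nonneg fun i _ => hq _
  set B : (Fin m → α) × (Fin m → α) → Prop := fun z => ∃ D ∈ H,
    ε / 8 * max (hitCount D z.1 + hitCount D z.2) (m * p) ≤ |hitCount D z.1 - hitCount D z.2|
  set far : (Fin m → α) → Prop := fun s => ∃ D ∈ H,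
    ε * (m * max (∑ b ∈ D, q b) p) < |hitCount D s - m * ∑ b ∈ D, q b|
  have hB := weightOf_le_of_swapBy hq hq1 B
    (weightOf_exists_discrepancy_le H hε hε1 hp hp1 hm0)
  -- The 4 in `4 / δ` covers the two tails of Hoeffding and the factor 2 lost to the ghost sample.
  have hbound : 2 * Real.exp (H.vcDim * Real.log (512 / (ε ^ 2 * p)) - m * ε ^ 2 * p / 256) ≤
      δ / 2 := by
    have : Real.exp (H.vcDim * Real.log (512 / (ε ^ 2 * p)) - m * ε ^ 2 * p / 256) ≤
        Real.exp (-Real.log (4 / δ)) := Real.exp_le_exp.2 (by linarith)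
    rw [Real.exp_neg, Real.exp_log (by positivity), inv_div] at this
    linarith
  have hghost : 1 / 2 * weightOf w far ≤ weightOf (fun z : (Fin m → α) × (Fin m → α) =>
      (∏ i, q (z.1 i)) * ∏ i, q (z.2 i)) B := by
    have hsplit : weightOf (fun z : (Fin m → α) × (Fin m → α) =>
        (∏ i, q (z.1 i)) * ∏ i, q (z.2 i)) B =
        ∑ s, w s * weightOf w (fun s' => B (s, s')) := by
      simp only [weightOf, Fintype.sum_prod_type, mul_sum, hwdef, mul_assoc]
    rw [hsplit, weightOf, mul_sum]
    refine sum_le_sum fun s _ => ?_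
    rw [mul_left_comm]
    refine mul_le_mul_of_nonneg_left ?_ (hw s)
    split_ifs with h
    · obtain ⟨D, hD, h⟩ := h
      rw [mul_one]
      refine (half_le_weightOf_hitCount_near hq hq1 D hε hε1 hm256).trans ?_
      refine weightOf_mono hw fun s' hs' => ⟨D, hD, ?_⟩
      refine discrepancy_of_far_of_near hε hε1 ?_ ?_ ?_ h hs'
      · exact mul_pos hm' (lt_max_of_lt_right hp)
      · gcongr
        exact le_max_right _ _
      · gcongr
        exact le_max_left _ _
    · rw [mul_zero]
      exact weightOf_nonneg hw _
  linarith

end Symmetrization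

/-! ### The VC dimension of disagreement sets. -/

section VCDimension

variable {V : Type*} [DecidableEq V] [Fintype V]

lemma sep_eq_zero_iff (C : Clustering V) (e : Edge V) :
    sep C e = 0 ↔ ∃ A ∈ C.parts, ∀ v ∈ e.1, v ∈ A := by
  unfold sep
  split_ifs with h <;> simp [h]

lemma sep_eq_one_iff (C : Clustering V) (e : Edge V) :
    sep C e = 1 ↔ ¬ ∃ A ∈ C.parts, ∀ v ∈ e.1, v ∈ A := by
  unfold sep
  split_ifs with h <;> simp [h]

lemma mem_disagreements_iff (G : Instance V) (C : Clustering V) (e : Edge V) :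
    e ∈ G.disagreements C ↔ ((∃ A ∈ C.parts, ∀ v ∈ e.1, v ∈ A) ↔ e ∉ G.pos) := by
  simp only [Instance.disagreements, mem_filter, mem_univ, true_and, sep_eq_zero_iff,
    sep_eq_one_iff]
  by_cases h : e ∈ G.pos <;> simp [h]

lemma mem_disagreementClass_iff (G : Instance V) (D : Finset (Edge V)) :
    D ∈ G.disagreementClass ↔ ∃ C : Clustering V, G.disagreements C = D := by
  simp [Instance.disagreementClass]

/-- Every edge pattern on a shattered set is realised by a clustering. -/
lemma exists_clustering_of_shatters {G : Instance V} {S : Finset (Edge V)}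
    (hS : G.disagreementClass.Shatters S) (U : Edge V → Prop) :
    ∃ C : Clustering V, ∀ e ∈ S, (∃ A ∈ C.parts, ∀ v ∈ e.1, v ∈ A) ↔ U e := by
  classical
  -- An edge is a disagreement exactly when being uncut is equivalent to being negative, so the
  -- signs only relabel the patterns.
  obtain ⟨D, hD, hSD⟩ := hS (filter_subset (fun e => U e ↔ e ∉ G.pos) S)
  obtain ⟨C, rfl⟩ := (mem_disagreementClass_iff G D).1 hD
  refine ⟨C, fun e he => ?_⟩
  have h := Finset.ext_iff.1 hSD e
  rw [mem_inter, mem_filter, mem_disagreements_iff, and_congr_right_iff] at h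
  by_cases hp : e ∈ G.pos
  · simpa only [hp, not_true_eq_false, iff_false, not_iff_not] using h he
  · simpa only [hp, not_false_eq_true, iff_true] using h he

/-- A set of edges each of which can be cut without cutting the others is at most a spanning
forest. -/
lemma card_le_of_forall_exists_cut {S : Finset (Edge V)} [Nonempty V]
    (h : ∀ e ∈ S, ∃ C : Clustering V,
      ∀ e' ∈ S, (∃ A ∈ C.parts, ∀ v ∈ e'.1, v ∈ A) ↔ e' ≠ e) :
    #S + 1 ≤ Fintype.card V := by
  classical
  obtain ⟨r⟩ := ‹Nonempty V›
  have hends : ∀ e : Edge V, ∃ u v, e.1 = s(u, v) := fun e => by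
    induction e.1 using Sym2.ind with
    | _ u v => exact ⟨u, v, rfl⟩
  choose a b hab using hends
  -- The oriented incidence vectors, with one root indicator added, are shown independent in `V →
  -- ℝ`; the root accounts for the `+ 1`. Summing a relation over all of `V` kills the root
  -- coefficient. Summing over the cluster of one end of `e`, in a clustering cutting only `e` among
  -- `S`, isolates the coefficient of `e`.
  let x : Option S → V → ℝ
    | none => Pi.single r 1
    | some e => Pi.single (a e) 1 - Pi.single (b e) 1
  have hli : LinearIndependent ℝ x := by
    rw [Fintype.linearIndependent_iff]
    intro g hg
    have hsum : ∀ A : Finset V, g none * (if r ∈ A then 1 else 0) +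
        ∑ e : S, g (some e) * ((if a e ∈ A then 1 else 0) - if b e ∈ A then 1 else 0) = 0 := by
      intro A
      have := congrArg (fun y : V → ℝ => ∑ v ∈ A, y v) hg
      simp only [Fintype.sum_option, Finset.sum_apply, Pi.smul_apply,
        smul_eq_mul, Pi.zero_apply, sum_const_zero, sum_add_distrib, x] at this
      rw [sum_comm] at this
      simpa only [← mul_sum, Pi.sub_apply, sum_sub_distrib, Pi.single_apply, sum_ite_eq',
        sum_ite_eq] using this
    have hnone : g none = 0 := by simpa using hsum univ
    have hsome : ∀ e : S, g (some e) = 0 := by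
      intro e
      obtain ⟨C, hC⟩ := h e e.2
      have hA := hsum (C.part (a e))
      rw [hnone, zero_mul, zero_add, sum_eq_single e] at hA
      · have hb : b e ∉ C.part (a e) := fun hb => by
          refine (hC e e.2).1 ⟨C.part (a e), C.part_mem.2 (mem_univ _), ?_⟩ rfl
          rw [hab]
          simp [hb]
        simpa [hb] using hA
      · intro e' _ hne
        obtain ⟨A, hA, hmem⟩ := (hC e' e'.2).2 fun h => hne (Subtype.ext h)
        rw [hab] at hmem
        have hA' : a e' ∈ A ∧ b e' ∈ A := by simpa using hmem
        have : a e' ∈ C.part (a e) ↔ b e' ∈ C.part (a e) := by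
          rw [C.mem_part_iff_part_eq_part (mem_univ _) (mem_univ _),
            C.mem_part_iff_part_eq_part (mem_univ _) (mem_univ _),
            C.part_eq_of_mem hA hA'.1, C.part_eq_of_mem hA hA'.2]
        simp [this]
      · simp
    rintro (_ | e)
    exacts [hnone, hsome e]
  simpa using hli.fintype_card_le_finrank

/-- At most two clusters are needed: `r` with the vertices satisfying `U`, and all the others. -/
lemma exists_clustering_star (r : V) (U : V → Prop) :
    ∃ C : Clustering V, ∀ v ≠ r, (∃ A ∈ C.parts, r ∈ A ∧ v ∈ A) ↔ U v := by
  classical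
  let s : Setoid V := Setoid.ker fun v => v = r ∨ U v
  refine ⟨Finpartition.ofSetoid s, fun v hv => ?_⟩
  rw [← Finpartition.mem_part_iff_exists, Finpartition.mem_part_ofSetoid_iff_rel]
  simp [s, hv]

/-- The disagreement sets of clusterings of `n` vertices have VC dimension `n - 1`. -/
theorem vcDim_disagreementClass [Nonempty V] (G : Instance V) :
    G.disagreementClass.vcDim = Fintype.card V - 1 := by
  classical
  refine le_antisymm (Finset.sup_le fun S hS => ?_) ?_
  · have := card_le_of_forall_exists_cut fun e _ =>
      exists_clustering_of_shatters (mem_shatterer.1 hS) fun e' => e' ≠ e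
    omega
  · obtain ⟨r⟩ := ‹Nonempty V›
    let f : {v : V // v ≠ r} → Edge V := fun v => ⟨s(r, v), by simpa using v.2.symm⟩
    have hf : Function.Injective f := fun u v huv => by
      exact Subtype.ext (Sym2.congr_right.1 (congrArg Subtype.val huv))
    have hcard : #(univ.image f) = Fintype.card V - 1 := by
      rw [card_image_of_injective _ hf, card_univ, Fintype.card_subtype_compl,
        Fintype.card_subtype_eq]
    rw [← hcard]
    refine Shatters.card_le_vcDim fun t ht => ?_
    obtain ⟨C, hC⟩ := exists_clustering_star r fun v =>
      ∀ hv : v ≠ r, f ⟨v, hv⟩ ∈ t ↔ f ⟨v, hv⟩ ∉ G.pos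
    refine ⟨G.disagreements C, (mem_disagreementClass_iff _ _).2 ⟨C, rfl⟩, ?_⟩
    have key : ∀ v, f v ∈ G.disagreements C ↔ f v ∈ t := by
      rintro ⟨v, hv⟩
      have hv' := (hC v hv).trans (forall_prop_of_true hv)
      have hends : (∃ A ∈ C.parts, ∀ w ∈ (f ⟨v, hv⟩).1, w ∈ A) ↔
          ∃ A ∈ C.parts, r ∈ A ∧ v ∈ A := by simp [f]
      rw [mem_disagreements_iff, hends, hv']
      by_cases hp : f ⟨v, hv⟩ ∈ G.pos <;> simp [hp]
    ext e
    rw [mem_inter]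
    refine ⟨fun ⟨he, h⟩ => ?_, fun he => ⟨ht he, ?_⟩⟩
    · obtain ⟨v, -, rfl⟩ := mem_image.1 he
      exact (key v).1 h
    · obtain ⟨v, -, rfl⟩ := mem_image.1 (ht he)
      exact (key v).2 he

end VCDimension

/-! ### From set deviations to clustering costs, and the sample size. -/

section Sparsification

variable {V : Type*} [DecidableEq V] [Fintype V]

lemma obj_eq_sum_disagreements (G : Instance V) (C : Clustering V) :
    G.obj C = ∑ e ∈ G.disagreements C, G.weight e := by
  have hsep : ∀ e, sep C e = 0 ∨ sep C e = 1 := fun e => by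
    unfold sep
    split_ifs <;> simp
  rw [Instance.obj, Instance.disagreements, sum_filter, ← sum_add_sum_compl G.pos]
  congr 1 <;>
  · refine sum_congr rfl fun e he => ?_
    rcases hsep e with h | h <;> simp_all

lemma sampled_obj_eq {m : ℕ} (G : Instance V) (s : Fin m → Edge V) (C : Clustering V) :
    (G.sampled s).obj C = G.totalWeight / m * hitCount (G.disagreements C) s := by
  rw [obj_eq_sum_disagreements]
  change ∑ e ∈ G.disagreements C, ∑ i, (if s i = e then G.totalWeight / m else 0) = _
  rw [sum_comm, hitCount, mul_sum]
  refine sum_congr rfl fun i _ => ?_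
  rw [sum_ite_eq]
  split_ifs <;> simp

lemma obj_eq_mul_mass (G : Instance V) (hW : 0 < G.totalWeight) (C : Clustering V) :
    G.obj C = G.totalWeight * ∑ e ∈ G.disagreements C, G.weight e / G.totalWeight := by
  rw [obj_eq_sum_disagreements, ← sum_div, mul_div_cancel₀ _ hW.ne']

lemma obj_nonneg (G : Instance V) (C : Clustering V) : 0 ≤ G.obj C := by
  rw [obj_eq_sum_disagreements]
  exact sum_nonneg fun e _ => G.weight_nonneg e

lemma obj_le_totalWeight (G : Instance V) (C : Clustering V) : G.obj C ≤ G.totalWeight := by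
  rw [obj_eq_sum_disagreements]
  exact sum_le_sum_of_subset_of_nonneg (subset_univ _) fun e _ _ => G.weight_nonneg e

lemma sampled_obj_le_totalWeight {m : ℕ} (G : Instance V) (hW : 0 < G.totalWeight)
    (s : Fin m → Edge V) (C : Clustering V) : (G.sampled s).obj C ≤ G.totalWeight := by
  rw [sampled_obj_eq]
  have h : hitCount (G.disagreements C) s ≤ m := by
    refine (sum_le_sum (g := fun _ => (1 : ℝ)) fun i _ => ?_).trans_eq (by simp)
    split_ifs <;> norm_num
  calc G.totalWeight / m * hitCount (G.disagreements C) s ≤ G.totalWeight / m * m := by gcongr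
    _ ≤ G.totalWeight := by
      -- For an empty sample, division by zero makes every sampled weight 0.
      rcases eq_or_ne (m : ℝ) 0 with h0 | h0
      · simp [h0, hW.le]
      · rw [div_mul_cancel₀ _ h0]

lemma sum_weight_div (G : Instance V) (hW : 0 < G.totalWeight) :
    ∑ e, G.weight e / G.totalWeight = 1 := by
  rw [← sum_div]
  exact div_self hW.ne'

lemma sampleLaw_real_eq (G : Instance V) (hW : 0 < G.totalWeight) (m : ℕ)
    (P : (Fin m → Edge V) → Prop) :
    (G.sampleLaw hW m).real {s | P s} =
      weightOf (fun s : Fin m → Edge V => ∏ i, G.weight (s i) / G.totalWeight) P := by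
  classical
  have : MeasureTheory.IsProbabilityMeasure (G.sampleLaw hW m) := by
    unfold Instance.sampleLaw
    infer_instance
  have hsingle : ∀ s : Fin m → Edge V, (G.sampleLaw hW m).real {s} =
      ∏ i, G.weight (s i) / G.totalWeight := fun s => by
    rw [MeasureTheory.measureReal_def, Instance.sampleLaw, MeasureTheory.Measure.pi_singleton,
      ENNReal.toReal_prod]
    refine prod_congr rfl fun i _ => ?_
    rw [PMF.toMeasure_apply_singleton _ _ (MeasurableSet.singleton _), Instance.edgeDist,
      PMF.ofFintype_apply, ENNReal.toReal_ofReal (div_nonneg (G.weight_nonneg _) hW.le)]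
  have hset : {s | P s} = ((univ.filter P : Finset (Fin m → Edge V)) : Set _) := by
    ext s
    simp
  rw [hset, ← MeasureTheory.sum_measureReal_singleton, weightOf, sum_filter]
  refine sum_congr rfl fun s _ => ?_
  rw [hsingle]
  split_ifs <;> simp

lemma abs_sampled_obj_sub_obj {m : ℕ} (hm : 0 < m) (G : Instance V) (hW : 0 < G.totalWeight)
    (s : Fin m → Edge V) (C : Clustering V) :
    |(G.sampled s).obj C - G.obj C| = G.totalWeight / m * |hitCount (G.disagreements C) s -
      m * ∑ e ∈ G.disagreements C, G.weight e / G.totalWeight| := by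
  have hm' : (0 : ℝ) < m := by exact_mod_cast hm
  rw [sampled_obj_eq, obj_eq_mul_mass G hW, ← abs_of_pos (div_pos hW hm'), ← abs_mul,
    abs_of_pos (div_pos hW hm')]
  congr 1
  field_simp

/-- The deviation bound for clusterings, at relative accuracy `ε` and threshold `p` times the total
weight. -/
lemma weightOf_exists_clustering_far_le [Nonempty V] {m : ℕ} (hm0 : 0 < m) (G : Instance V)
    (hW : 0 < G.totalWeight) {ε p δ : ℝ} (hε : 0 < ε) (hε1 : ε ≤ 1) (hp : 0 < p) (hp1 : p ≤ 1)
    (hδ : 0 < δ) (hδ1 : δ < 1)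
    (hm : ((Fintype.card V : ℝ) - 1) * Real.log (512 / (ε ^ 2 * p)) + Real.log (4 / δ) ≤
      m * ε ^ 2 * p / 256) :
    weightOf (fun s : Fin m → Edge V => ∏ i, G.weight (s i) / G.totalWeight) (fun s =>
      ∃ C : Clustering V, ε * max (G.obj C) (G.totalWeight * p) <
        |(G.sampled s).obj C - G.obj C|) ≤ δ := by
  have hm' : (0 : ℝ) < m := by exact_mod_cast hm0
  have hq : ∀ e, 0 ≤ G.weight e / G.totalWeight := fun e => div_nonneg (G.weight_nonneg e) hW.le
  refine (weightOf_mono (fun s => prod_nonneg fun i _ => hq _) ?_).trans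
    (weightOf_exists_far_le hq (sum_weight_div G hW) G.disagreementClass hε hε1 hp hp1 hδ hδ1 ?_)
  · rintro s ⟨C, hC⟩
    refine ⟨_, (mem_disagreementClass_iff G _).2 ⟨C, rfl⟩, ?_⟩
    rw [abs_sampled_obj_sub_obj hm0 G hW, obj_eq_mul_mass G hW,
      ← mul_max_of_nonneg _ _ hW.le] at hC
    refine lt_of_mul_lt_mul_left (lt_of_eq_of_lt ?_ hC) (div_pos hW hm').le
    field_simp
  · rwa [vcDim_disagreementClass, Nat.cast_sub Fintype.card_pos, Nat.cast_one]

/-- Used with `r = 1 / p`. The terms without `L` or `A` total at most `(7 + 1 + 2) * d * r`, and `L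
/ L₀ ≥ 1` turns them into `10 / L₀ * (d * L) * r`. -/
lemma complexity_le {L₀ L A d r X : ℝ} (hL₀ : 0 < L₀) (hL : L₀ ≤ L) (hA : 0 ≤ A) (hd : 1 ≤ d)
    (hr : 1 ≤ r) (hX : X ≤ 7 + 2 * L + r) :
    d * X + (A + 2) ≤ (10 / L₀ + 2) * (d * L + A) * r := by
  have h1 : 10 * (d * r) ≤ 10 / L₀ * (d * L) * r := by
    have : 1 ≤ L / L₀ := (one_le_div hL₀).2 hL
    calc 10 * (d * r) ≤ 10 * (d * r) * (L / L₀) := le_mul_of_one_le_right (by positivity) this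
      _ = _ := by ring
  have h2 : 0 ≤ 10 / L₀ * A * r := by positivity
  have h3 : d * L ≤ d * L * r := le_mul_of_one_le_right (by nlinarith) hr
  have h4 : A ≤ A * r := le_mul_of_one_le_right hA hr
  have h5 : d * X ≤ d * (7 + 2 * L + r) := by gcongr
  have h6 : d ≤ d * r := le_mul_of_one_le_right (by linarith) hr
  nlinarith

lemma log_four_div_le {δ : ℝ} (hδ : 0 < δ) : Real.log (4 / δ) ≤ Real.log (1 / δ) + 2 := by
  rw [Real.log_div (by norm_num) hδ.ne', one_div, Real.log_inv,
    show (4 : ℝ) = 2 ^ 2 by norm_num, Real.log_pow]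
  have := Real.log_two_lt_d9
  norm_num
  linarith

/-- Bounding `log (1 / p)` by `1 / p` is affordable because the sample size carries a spare factor
`W / τ`. -/
lemma log_div_sq_mul_le {ε p : ℝ} (hε : 0 < ε) (hp : 0 < p) :
    Real.log (512 / (ε ^ 2 * p)) ≤ 7 + 2 * Real.log (1 / ε) + 1 / p := by
  have hp' : -Real.log p ≤ 1 / p := by
    rw [← Real.log_inv, one_div]
    linarith [Real.log_le_sub_one_of_pos (inv_pos.2 hp)]
  have h2 := Real.log_two_lt_d9
  rw [Real.log_div (by norm_num) (by positivity), Real.log_mul (by positivity) hp.ne',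
    Real.log_pow, show (512 : ℝ) = 2 ^ 9 by norm_num, Real.log_pow, one_div ε, Real.log_inv]
  push_cast
  linarith

lemma two_le_card_of_totalWeight_pos (G : Instance V) (hW : 0 < G.totalWeight) :
    2 ≤ Fintype.card V := by
  by_contra! h
  have : Subsingleton V := Fintype.card_le_one_iff_subsingleton.1 (by omega)
  have : IsEmpty (Edge V) := ⟨fun ⟨e, he⟩ => he (by
    induction e using Sym2.ind with
    | _ u v => simp [Subsingleton.elim u v])⟩
  simp [Instance.totalWeight] at hW

lemma weightOf_exists_clustering_violating_le {ε₀ : ℝ} (hε₀ : 0 < ε₀) (hε₀1 : ε₀ < 1)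
    (G : Instance V) (hW : 0 < G.totalWeight) {ε δ τ : ℝ} (hε : 0 < ε) (hεε₀ : ε ≤ ε₀)
    (hδ : 0 < δ) (hδ1 : δ < 1) (hτ : 0 < τ) {m : ℕ}
    (hm : 256 * (10 / Real.log (1 / ε₀) + 2) *
      ((((Fintype.card V : ℝ) - 1) * Real.log (1 / ε) + Real.log (1 / δ)) / ε ^ 2
        * (G.totalWeight ^ 2 / τ ^ 2)) ≤ (m : ℝ)) :
    weightOf (fun s : Fin m → Edge V => ∏ i, G.weight (s i) / G.totalWeight) (fun s =>
      ∃ C : Clustering V, ε * max (G.obj C) τ < |(G.sampled s).obj C - G.obj C|) ≤ δ := by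
  set W := G.totalWeight with hWdef
  have hq : ∀ e, 0 ≤ G.weight e / W := fun e => div_nonneg (G.weight_nonneg e) hW.le
  have hcard := two_le_card_of_totalWeight_pos G hW
  have : Nonempty V := Fintype.card_pos_iff.1 (by omega)
  have hd : 1 ≤ (Fintype.card V : ℝ) - 1 := by
    have : (2 : ℝ) ≤ Fintype.card V := by exact_mod_cast hcard
    linarith
  have hL₀ : 0 < Real.log (1 / ε₀) := Real.log_pos ((one_lt_div hε₀).2 hε₀1)
  have hL : Real.log (1 / ε₀) ≤ Real.log (1 / ε) :=
    Real.log_le_log (by positivity) (one_div_le_one_div_of_le hε hεε₀)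
  have hA : 0 < Real.log (1 / δ) := Real.log_pos ((one_lt_div hδ).2 hδ1)
  set L₀ := Real.log (1 / ε₀)
  set L := Real.log (1 / ε) with hLdef
  set A := Real.log (1 / δ)
  set d := (Fintype.card V : ℝ) - 1
  have hdLA : 0 < d * L + A := by
    have : 0 < L := hL₀.trans_le hL
    positivity
  have hm' : (0 : ℝ) < m := lt_of_lt_of_le (by positivity) hm
  have hm0 : 0 < m := by exact_mod_cast hm'
  have hlog4 := log_four_div_le hδ
  have hm2 : (10 / L₀ + 2) * (d * L + A) ≤ m * (ε * (τ / W)) ^ 2 / 256 := by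
    calc (10 / L₀ + 2) * (d * L + A) =
          256 * (10 / L₀ + 2) * ((d * L + A) / ε ^ 2 * (W ^ 2 / τ ^ 2)) *
            (ε * (τ / W)) ^ 2 / 256 := by field_simp
      _ ≤ _ := by gcongr
  -- The deviation bound needs a threshold `p ≤ 1`. If `τ > W`, every cost is below `τ`, and the
  -- allowed error `ε * τ` is that of accuracy `ε * (τ / W)` at `p = 1`. If this accuracy exceeds 1,
  -- the allowed error exceeds `W`, which no deviation does.
  rcases le_or_gt τ W with hτW | hτW
  · have hp : 0 < τ / W := by positivity
    have hp1 : τ / W ≤ 1 := (div_le_one hW).2 hτW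
    have := weightOf_exists_clustering_far_le (p := τ / W) hm0 G hW hε (by linarith) hp hp1 hδ
      hδ1 ?_
    · rwa [mul_div_cancel₀ _ hW.ne'] at this
    · have h1 := complexity_le hL₀ hL hA.le hd ((one_le_div hp).2 hp1)
        (log_div_sq_mul_le hε hp)
      have h2 : (10 / L₀ + 2) * (d * L + A) * (1 / (τ / W)) ≤ m * ε ^ 2 * (τ / W) / 256 := by
        rw [mul_one_div, div_le_iff₀ hp]
        refine hm2.trans_eq ?_
        ring
      exact (add_le_add le_rfl hlog4).trans (h1.trans h2)
  · rcases le_or_gt (ε * (τ / W)) 1 with hετ | hετ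
    · have hτW1 : 1 ≤ τ / W := (one_le_div hW).2 hτW.le
      have hpos : 0 < ε * (τ / W) := by positivity
      refine (weightOf_mono (fun s => prod_nonneg fun i _ => hq _) ?_).trans
        (weightOf_exists_clustering_far_le (p := 1) hm0 G hW hpos hετ one_pos le_rfl hδ hδ1 ?_)
      · rintro s ⟨C, hC⟩
        refine ⟨C, lt_of_eq_of_lt ?_ hC⟩
        have hobj := obj_le_totalWeight G C
        rw [mul_one, max_eq_right hobj, max_eq_right (hobj.trans hτW.le), ← hWdef, mul_assoc,
          div_mul_cancel₀ _ hW.ne']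
      · have h0 := log_div_sq_mul_le hpos one_pos
        have h1 : Real.log (1 / (ε * (τ / W))) ≤ L :=
          Real.log_le_log (by positivity)
            (one_div_le_one_div_of_le hε (le_mul_of_one_le_right hε.le hτW1))
        have h2 := complexity_le (r := 1) hL₀ hL hA.le hd le_rfl
          (X := Real.log (512 / ((ε * (τ / W)) ^ 2 * 1))) (by linarith)
        rw [mul_one] at h2 ⊢
        exact (add_le_add le_rfl hlog4).trans (h2.trans (by rwa [mul_one, mul_one]))
    · refine (weightOf_mono (Q := fun _ => False) (fun s => prod_nonneg fun i _ => hq _) ?_).trans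
        (by simpa [weightOf] using hδ.le)
      rintro s ⟨C, hC⟩
      have h1 : W < ε * max (G.obj C) τ := by
        have : W < ε * τ := by rwa [← mul_div_assoc, one_lt_div hW] at hετ
        exact this.trans_le (by gcongr; exact le_max_right _ _)
      have h2 : |(G.sampled s).obj C - G.obj C| ≤ W := abs_le.2
        ⟨by linarith [obj_nonneg (G.sampled s) C, obj_le_totalWeight G C],
          by linarith [obj_nonneg G C, sampled_obj_le_totalWeight G hW s C]⟩
      linarith

end Sparsification

end CorrelationClustering

theorem theoremB1 :
    ∀ ε₀ : ℝ, 0 < ε₀ → ε₀ < 1 → ∃ c : ℝ, 0 < c ∧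
      ∀ (V : Type*) [DecidableEq V] [Fintype V] (G : CorrelationClustering.Instance V)
        (hW : 0 < G.totalWeight),
        G.disagreementClass.vcDim = Fintype.card V - 1 ∧
        ∀ (ε δ τ : ℝ), 0 < ε → ε ≤ ε₀ → 0 < δ → δ < 1 → 0 < τ →
          ∀ m : ℕ,
            c * ((((Fintype.card V : ℝ) - 1) * Real.log (1 / ε) + Real.log (1 / δ)) / ε ^ 2
              * (G.totalWeight ^ 2 / τ ^ 2)) ≤ (m : ℝ) →
            1 - δ ≤ (G.sampleLaw hW m).real
              {s | ∀ C : CorrelationClustering.Clustering V,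
                (τ ≤ G.obj C → |(G.sampled s).obj C - G.obj C| ≤ ε * G.obj C) ∧
                |(G.sampled s).obj C - G.obj C| ≤ ε * max (G.obj C) τ} := by
  intro ε₀ hε₀ hε₀1
  have hL₀ : 0 < Real.log (1 / ε₀) := Real.log_pos ((one_lt_div hε₀).2 hε₀1)
  refine ⟨256 * (10 / Real.log (1 / ε₀) + 2), by positivity, fun V _ _ G hW => ⟨?_, ?_⟩⟩
  · have hcard := CorrelationClustering.two_le_card_of_totalWeight_pos G hW
    have : Nonempty V := Fintype.card_pos_iff.1 (by omega)
    exact CorrelationClustering.vcDim_disagreementClass G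
  · intro ε δ τ hε hεε₀ hδ hδ1 hτ m hm
    have hbad := CorrelationClustering.weightOf_exists_clustering_violating_le hε₀ hε₀1 G hW hε
      hεε₀ hδ hδ1 hτ hm
    have hadd := CorrelationClustering.weightOf_add_weightOf_not
      (w := fun s : Fin m → CorrelationClustering.Edge V => ∏ i, G.weight (s i) / G.totalWeight)
      (fun s => ∃ C : CorrelationClustering.Clustering V,
        ε * max (G.obj C) τ < |(G.sampled s).obj C - G.obj C|)
    rw [CorrelationClustering.sum_prod_eq_one (CorrelationClustering.sum_weight_div G hW)] at hadd
    rw [CorrelationClustering.sampleLaw_real_eq]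
    refine le_trans (by linarith) (CorrelationClustering.weightOf_mono
      (fun s => Finset.prod_nonneg fun i _ => div_nonneg (G.weight_nonneg _) hW.le) ?_)
    intro s hs C
    have hC : |(G.sampled s).obj C - G.obj C| ≤ ε * max (G.obj C) τ :=
      not_lt.1 fun h => hs ⟨C, h⟩
    exact ⟨fun hτC => by rwa [max_eq_left hτC] at hC, hC⟩
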